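/- Let $(M,g)$ be a smooth pseudo-Riemannian spin manifold of dimension $n$ and arbitrary signature, with Levi-Civita connection $\nabla$. Let $S\to M$ be the (real or complex) spinor bundle, i.e. the vector bundle associated with the spin structure by a finite-dimensional module of the Clifford algebra with $vw+wv=-2g(v,w)$, let $\gamma(X)\xi$ denote Clifford multiplication, and let $C$ be a charge conjugation on $S$: a nondegenerate spin-invariant bilinear form such that, for signs $\Delta_0,\Delta_1\in\{\pm1\}$, $C(\eta,\xi)=\Delta_0\,C(\xi,\eta)$ and $C(\eta,\gamma(X)\xi)=\Delta_1\,C(\xi,\gamma(X)\eta)$. (In indefinite signature the spin group is the group of even products $s$ of invertible vectors whose product with their reversal is $1$; this is the group that preserves such forms.) For spinor fields $\eta,\xi$ let $\{\eta,\xi\}$ be the vector field (complex if $S$ is complex) given by $g(\{\eta,\xi\},X)=2C_1(\eta\otimes\xi)(X)=2\,C(\eta,\gamma(X)\xi)$. Let $D$ be a connection on $S$, and let $D^C$ be the connection on $S$ determined by $$X\,C(\eta,\xi)=C(D_X\eta,\xi)+C(\eta,D^C_X\xi).$$ Put $$(\hat D_X\gamma)(Y)\xi=D_X(\gamma(Y)\xi)-\gamma(\nabla_XY)\xi-\gamma(Y)D^C_X\xi,$$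 and let the torsion $\mathcal T(X,Y)=(\hat D_X\gamma)(Y)-(\hat D_Y\gamma)(X)$ be twice the skew-symmetric part of $\hat D\gamma$. Let $\varphi,\psi$ be smooth spinor fields with $D^C\varphi=D^C\psi=0$ on which the symmetric part of $\hat D\gamma$ acts trivially, i.e. $(\hat D_X\gamma)(Y)\xi+(\hat D_Y\gamma)(X)\xi=0$ for $\xi=\varphi,\psi$ and all vector fields $X,Y$. Then $\{\varphi,\psi\}$ is a Killing vector field, i.e. it is smooth and $\mathcal L_{\{\varphi,\psi\}}g=0$ (for complex $S$: its real and imaginary parts are Killing), and for all vector fields $X,Y$ $$g(\nabla_X\{\varphi,\psi\},Y)=C(\varphi,\mathcal T(X,Y)\psi),$$ where $g$ and $\nabla$ are extended complex-linearly to complex vector fields. -/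

import Mathlib

open Bundle VectorField
open scoped Manifold ContDiff Topology

noncomputable section

namespace SpinGeom

/-! ### Pseudo-Riemannian metrics, Levi-Civita connection, Killing fields -/

section Metric

variable {n : ℕ} (M : Type*) [TopologicalSpace M] [ChartedSpace (EuclideanSpace ℝ (Fin n)) M]
  [IsManifold (𝓡 n) ∞ M]

/-- A smooth pseudo-Riemannian metric (of arbitrary signature) on an `n`-dimensional manifold. -/
structure PseudoRiemannianMetric where
  val (x : M) : TangentSpace (𝓡 n) x →L[ℝ] TangentSpace (𝓡 n) x →L[ℝ] ℝ
  symm (x : M) (v w : TangentSpace (𝓡 n) x) : val x v w = val x w v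
  nondegenerate (x : M) (v : TangentSpace (𝓡 n) x) (hv : ∀ w, val x v w = 0) : v = 0
  contMDiff : ContMDiff (𝓡 n)
    ((𝓡 n).prod 𝓘(ℝ, EuclideanSpace ℝ (Fin n) →L[ℝ] EuclideanSpace ℝ (Fin n) →L[ℝ] ℝ)) ∞
    (fun x ↦ TotalSpace.mk'
      (EuclideanSpace ℝ (Fin n) →L[ℝ] EuclideanSpace ℝ (Fin n) →L[ℝ] ℝ) x (val x))

variable {M}

/-- The vector field `X` is differentiable at `x`. -/
abbrev DiffVecAt (X : Π x : M, TangentSpace (𝓡 n) x) (x : M) : Prop :=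
  MDifferentiableAt (𝓡 n) ((𝓡 n).prod 𝓘(ℝ, EuclideanSpace ℝ (Fin n)))
    (fun y ↦ TotalSpace.mk' (EuclideanSpace ℝ (Fin n)) y (X y)) x

/-- The vector field `X` is smooth on the set `s`. -/
abbrev SmoothVecOn (X : Π x : M, TangentSpace (𝓡 n) x) (s : Set M) : Prop :=
  ContMDiffOn (𝓡 n) ((𝓡 n).prod 𝓘(ℝ, EuclideanSpace ℝ (Fin n))) ∞
    (fun y ↦ TotalSpace.mk' (EuclideanSpace ℝ (Fin n)) y (X y)) s

namespace PseudoRiemannianMetric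

variable (g : PseudoRiemannianMetric (n := n) M)

/-- The metric at `x` as an algebraic bilinear form. -/
def bilin (x : M) : LinearMap.BilinForm ℝ (TangentSpace (𝓡 n) x) :=
  ContinuousLinearMap.coeLM ℝ ∘ₗ (g.val x : TangentSpace (𝓡 n) x →ₗ[ℝ] _)

theorem bilin_nondegenerate (x : M) : (g.bilin x).Nondegenerate :=
  ⟨fun v hv ↦ g.nondegenerate x v hv,
    fun w hw ↦ g.nondegenerate x w fun v ↦ (g.symm x w v).trans (hw v)⟩

instance finiteDimensional_tangentSpace (x : M) :
    FiniteDimensional ℝ (TangentSpace (𝓡 n) x) :=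
  inferInstanceAs (FiniteDimensional ℝ (EuclideanSpace ℝ (Fin n)))

/-- The vector `α♯` with `g (α♯, w) = α w` for all `w`. -/
def sharp (x : M) (α : TangentSpace (𝓡 n) x →ₗ[ℝ] ℝ) : TangentSpace (𝓡 n) x :=
  ((g.bilin x).toDual (g.bilin_nondegenerate x)).symm α

/-- `∇` is the Levi-Civita connection of `g`: it is torsion free and `g` is parallel. -/
structure IsLeviCivita
    (nab : CovariantDerivative (𝓡 n) (EuclideanSpace ℝ (Fin n))
      (TangentSpace (𝓡 n) : M → Type _)) : Prop where
  torsionFree {X Y : Π x : M, TangentSpace (𝓡 n) x} {x : M}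
    (hX : DiffVecAt X x) (hY : DiffVecAt Y x) :
    nab Y x (X x) - nab X x (Y x) = mlieBracket (𝓡 n) X Y x
  metric {X Y : Π x : M, TangentSpace (𝓡 n) x} {x : M}
    (hX : DiffVecAt X x) (hY : DiffVecAt Y x) (v : TangentSpace (𝓡 n) x) :
    mvfderiv (𝓡 n) (fun y ↦ g.val y (X y) (Y y)) x v =
      g.val x (nab X x v) (Y x) + g.val x (X x) (nab Y x v)

/-- The Lie derivative of the metric:
`(𝓛_K g)(X, Y) = K (g (X, Y)) - g ([K, X], Y) - g (X, [K, Y])`. -/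
def lieDeriv (K X Y : Π x : M, TangentSpace (𝓡 n) x) (x : M) : ℝ :=
  mvfderiv (𝓡 n) (fun y ↦ g.val y (X y) (Y y)) x (K x)
    - g.val x (mlieBracket (𝓡 n) K X x) (Y x) - g.val x (X x) (mlieBracket (𝓡 n) K Y x)

/-- A smooth vector field `K` with `𝓛_K g = 0`. -/
def IsKilling (K : Π x : M, TangentSpace (𝓡 n) x) : Prop :=
  SmoothVecOn K Set.univ ∧
    ∀ (x : M) (X Y : Π x : M, TangentSpace (𝓡 n) x),
      DiffVecAt X x → DiffVecAt Y x → g.lieDeriv K X Y x = 0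

end PseudoRiemannianMetric

end Metric

/-! ### Clifford modules and charge conjugations -/

section Clifford

variable {n : ℕ}

/-- The quadratic form `v ↦ -∑ a, ε a * (v a)²`, so that in its Clifford algebra
`v w + w v = -2 ⟨v, w⟩` for the inner product `⟨v, w⟩ = ∑ a, ε a * v a * w a`. -/
def cliffordForm (ε : Fin n → ℤˣ) : QuadraticForm ℝ (Fin n → ℝ) :=
  QuadraticMap.weightedSumSquares ℝ (fun a ↦ -((ε a : ℤ) : ℝ))

variable {𝕜 : Type*} [RCLike 𝕜] {F : Type*} [NormedAddCommGroup F] [NormedSpace ℝ F]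
  [NormedSpace 𝕜 F] [IsScalarTower ℝ 𝕜 F] [FiniteDimensional ℝ F] {ε : Fin n → ℤˣ}

/-- A charge conjugation on a real or complex Clifford module: a nondegenerate spin-invariant
bilinear form for which both `(φ, ψ) ↦ C (φ, ψ)` and `(φ, ψ) ↦ C (φ, v ψ)` have a definite
symmetry `Δ₀`, `Δ₁`. Here `spinGroup` consists of the even products `s` of invertible vectors with
`reverse s * s = 1`, which is the group that preserves such forms in every signature. -/
structure ChargeConjugation
    (ρ : CliffordAlgebra (cliffordForm ε) →ₐ[ℝ] Module.End 𝕜 F) where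
  form : LinearMap.BilinForm 𝕜 F
  nondegenerate : form.Nondegenerate
  spin_invariant : ∀ s ∈ spinGroup (cliffordForm ε), ∀ φ ψ : F,
    form (ρ s φ) (ρ s ψ) = form φ ψ
  Δ₀ : ℤˣ
  Δ₁ : ℤˣ
  symm₀ : ∀ φ ψ : F, form φ ψ = ((Δ₀ : ℤ) : 𝕜) * form ψ φ
  symm₁ : ∀ (v : Fin n → ℝ) (φ ψ : F),
    form φ (ρ (CliffordAlgebra.ι (cliffordForm ε) v) ψ) =
      ((Δ₁ : ℤ) : 𝕜) * form ψ (ρ (CliffordAlgebra.ι (cliffordForm ε) v) φ)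

end Clifford

/-! ### Spin structures and spinor bundles -/

section Spin

variable {n : ℕ} {M : Type*} [TopologicalSpace M] [ChartedSpace (EuclideanSpace ℝ (Fin n)) M]
  [IsManifold (𝓡 n) ∞ M]

/-- A spin structure on `(M, g)`, presented by an open cover with a smooth orthonormal frame of
type `ε` on each member, and a smooth cocycle in the spin group that lifts the transition functions
of these frames. -/
structure SpinStructure (g : PseudoRiemannianMetric (n := n) M) (ε : Fin n → ℤˣ)
    (ι : Type*) where
  baseSet : ι → Set M
  isOpen_baseSet : ∀ i, IsOpen (baseSet i)
  indexAt : M → ι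
  mem_baseSet_at : ∀ x, x ∈ baseSet (indexAt x)
  frame : ι → Fin n → Π x : M, TangentSpace (𝓡 n) x
  contMDiffOn_frame : ∀ i a, SmoothVecOn (frame i a) (baseSet i)
  orthonormal : ∀ i, ∀ x ∈ baseSet i, ∀ a b,
    g.val x (frame i a x) (frame i b x) = if a = b then ((ε a : ℤ) : ℝ) else 0
  /-- `trans i j` carries the description with respect to `i` to the one with respect to `j`. -/
  trans : ι → ι → M → CliffordAlgebra (cliffordForm ε)
  trans_mem : ∀ i j, ∀ x ∈ baseSet i ∩ baseSet j, trans i j x ∈ spinGroup (cliffordForm ε)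
  /-- Smoothness of the coordinates of `trans i j` in the finite-dimensional Clifford algebra. -/
  contMDiffOn_trans : ∀ i j (l : CliffordAlgebra (cliffordForm ε) →ₗ[ℝ] ℝ),
    ContMDiffOn (𝓡 n) 𝓘(ℝ, ℝ) ∞ (fun x ↦ l (trans i j x)) (baseSet i ∩ baseSet j)
  trans_self : ∀ i, ∀ x ∈ baseSet i, trans i i x = 1
  trans_comp : ∀ i j k, ∀ x ∈ baseSet i ∩ baseSet j ∩ baseSet k,
    trans j k x * trans i j x = trans i k x
  /-- `trans i j x` acts on vectors by conjugation as the change of frame at `x`. -/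
  trans_lift : ∀ i j, ∀ x ∈ baseSet i ∩ baseSet j, ∀ v w : Fin n → ℝ,
    ∑ a, v a • frame i a x = ∑ a, w a • frame j a x →
    trans i j x * CliffordAlgebra.ι (cliffordForm ε) v =
      CliffordAlgebra.ι (cliffordForm ε) w * trans i j x

variable {g : PseudoRiemannianMetric (n := n) M} {ε : Fin n → ℤˣ} {ι : Type*}
  (P : SpinStructure g ε ι)
  {𝕜 : Type*} [RCLike 𝕜] {F : Type*} [NormedAddCommGroup F] [NormedSpace ℝ F]
  [NormedSpace 𝕜 F] [IsScalarTower ℝ 𝕜 F] [FiniteDimensional ℝ F]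
  (ρ : CliffordAlgebra (cliffordForm ε) →ₐ[ℝ] Module.End 𝕜 F)

/-- The Clifford action, with values in the continuous real endomorphisms. -/
def actionCLM : CliffordAlgebra (cliffordForm ε) →ₗ[ℝ] (F →L[ℝ] F) where
  toFun s := LinearMap.toContinuousLinearMap ((ρ s).restrictScalars ℝ)
  map_add' s t := by ext; simp
  map_smul' c s := by ext; simp

theorem contMDiffOn_actionCLM_trans (i j : ι) :
    ContMDiffOn (𝓡 n) 𝓘(ℝ, F →L[ℝ] F) ∞ (fun x ↦ actionCLM ρ (P.trans i j x))
      (P.baseSet i ∩ P.baseSet j) := by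
  let b := Module.finBasis ℝ (F →L[ℝ] F)
  have h : (fun x ↦ actionCLM ρ (P.trans i j x)) =
      fun x ↦ ∑ k, (b.coord k ∘ₗ actionCLM ρ) (P.trans i j x) • b k := by
    funext x
    exact (b.sum_repr _).symm
  rw [h]
  exact contMDiffOn_finsetSum fun k _ ↦
    (P.contMDiffOn_trans i j (b.coord k ∘ₗ actionCLM ρ)).smul contMDiffOn_const

namespace SpinStructure

/-- The coordinates of a tangent vector with respect to the `i`-th orthonormal frame. -/
def coord (i : ι) (x : M) : TangentSpace (𝓡 n) x →ₗ[ℝ] (Fin n → ℝ) :=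
  LinearMap.pi fun a ↦ ((ε a : ℤ) : ℝ) • (g.val x (P.frame i a x)).toLinearMap

/-- The spinor bundle: the vector bundle with fibre `F` associated with the spin structure by the
action of the spin group on the Clifford module `F`. -/
def spinorBundle : VectorBundleCore ℝ M F ι where
  baseSet := P.baseSet
  isOpen_baseSet := P.isOpen_baseSet
  indexAt := P.indexAt
  mem_baseSet_at := P.mem_baseSet_at
  coordChange i j x := actionCLM ρ (P.trans i j x)
  coordChange_self i x hx v := by simp [actionCLM, P.trans_self i x hx]
  continuousOn_coordChange i j := (contMDiffOn_actionCLM_trans P ρ i j).continuousOn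
  coordChange_comp i j k x hx v := by simp [actionCLM, ← P.trans_comp i j k x hx]

instance : (P.spinorBundle ρ).IsContMDiff (𝓡 n) ∞ :=
  ⟨contMDiffOn_actionCLM_trans P ρ⟩

/-- The spinor space at `x`. As a type it is `F`, identified through the frame `P.indexAt x`. -/
abbrev Spinor (x : M) : Type _ := (P.spinorBundle ρ).Fiber x

instance (x : M) : IsTopologicalAddGroup (P.Spinor ρ x) :=
  inferInstanceAs (IsTopologicalAddGroup F)

instance (x : M) : ContinuousSMul ℝ (P.Spinor ρ x) :=
  inferInstanceAs (ContinuousSMul ℝ F)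

/-- The spinor field `ξ` is differentiable at `x`. -/
abbrev DiffSpinorAt {ρ : CliffordAlgebra (cliffordForm ε) →ₐ[ℝ] Module.End 𝕜 F}
    (ξ : Π x : M, P.Spinor ρ x) (x : M) : Prop :=
  MDifferentiableAt (𝓡 n) ((𝓡 n).prod 𝓘(ℝ, F)) (fun y ↦ TotalSpace.mk' F y (ξ y)) x

/-- The spinor field `ξ` is smooth. -/
abbrev SmoothSpinor {ρ : CliffordAlgebra (cliffordForm ε) →ₐ[ℝ] Module.End 𝕜 F}
    (ξ : Π x : M, P.Spinor ρ x) : Prop :=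
  ContMDiff (𝓡 n) ((𝓡 n).prod 𝓘(ℝ, F)) ∞ (fun y ↦ TotalSpace.mk' F y (ξ y))

/-- Clifford multiplication `γ (v) ψ` of a spinor by a tangent vector at `x`. -/
def clifford (x : M) (v : TangentSpace (𝓡 n) x) (ψ : P.Spinor ρ x) : P.Spinor ρ x :=
  (ρ (CliffordAlgebra.ι (cliffordForm ε) (P.coord (P.indexAt x) x v)) : F →ₗ[𝕜] F) ψ

variable {ρ} (C : ChargeConjugation ρ)

/-- The charge conjugation on the spinor space at `x`. -/
def pairing (x : M) (φ ψ : P.Spinor ρ x) : 𝕜 := C.form (φ : F) (ψ : F)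

/-- The form `C₁ (φ ⊗ ψ)`, that is `v ↦ C (φ, γ (v) ψ)`. -/
def C₁ (φ ψ : Π x : M, P.Spinor ρ x) (x : M) : TangentSpace (𝓡 n) x →ₗ[ℝ] 𝕜 where
  toFun v := P.pairing C x (φ x) (P.clifford ρ x v (ψ x))
  map_add' v w := by
    simp only [pairing, clifford, map_add]
    exact map_add _ _ _
  map_smul' c v := by
    simp only [pairing, clifford, map_smul]
    exact LinearMap.map_smul_of_tower _ _ _

/-- The real part of the `𝕜`-valued vector field `{φ, ψ} = 2 C₁ (φ ⊗ ψ)`, where forms are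
identified with vectors by the metric. For `𝕜 = ℝ` this is the whole field. -/
def bracketRe (φ ψ : Π x : M, P.Spinor ρ x) (x : M) : TangentSpace (𝓡 n) x :=
  g.sharp x (RCLike.reLm ∘ₗ ((2 : ℝ) • P.C₁ C φ ψ x))

/-- The imaginary part of the `𝕜`-valued vector field `{φ, ψ} = 2 C₁ (φ ⊗ ψ)`. -/
def bracketIm (φ ψ : Π x : M, P.Spinor ρ x) (x : M) : TangentSpace (𝓡 n) x :=
  g.sharp x (RCLike.imLm ∘ₗ ((2 : ℝ) • P.C₁ C φ ψ x))

variable (D DC : CovariantDerivative (𝓡 n) F (P.Spinor ρ))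
  (nab : CovariantDerivative (𝓡 n) (EuclideanSpace ℝ (Fin n)) (TangentSpace (𝓡 n) : M → Type _))

/-- `DC` is the connection `D^C` associated with `D`: the charge conjugation is parallel with
respect to `D ⊗ 1 + 1 ⊗ D^C`. As `C` is nondegenerate this determines `D^C`. -/
def IsChargeConjugate : Prop :=
  ∀ (φ ψ : Π x : M, P.Spinor ρ x) (x : M), P.DiffSpinorAt φ x → P.DiffSpinorAt ψ x →
    ∀ v : TangentSpace (𝓡 n) x,
      mvfderiv (𝓡 n) (fun y ↦ P.pairing C y (φ y) (ψ y)) x v =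
        P.pairing C x (D φ x v) (ψ x) + P.pairing C x (φ x) (DC ψ x v)

/-- `(D̂_Z γ)(X) ξ = D_Z (γ (X) ξ) - γ (∇_Z X) ξ - γ (X) D^C_Z ξ`. -/
def hatDGamma (Z X : Π x : M, TangentSpace (𝓡 n) x) (ξ : Π x : M, P.Spinor ρ x) (x : M) :
    P.Spinor ρ x :=
  D (fun y ↦ P.clifford ρ y (X y) (ξ y)) x (Z x) - P.clifford ρ x (nab X x (Z x)) (ξ x)
    - P.clifford ρ x (X x) (DC ξ x (Z x))

/-- The symmetric part of `D̂ γ`, applied to a spinor field. -/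
def symmPart (X Y : Π x : M, TangentSpace (𝓡 n) x) (ξ : Π x : M, P.Spinor ρ x) (x : M) :
    P.Spinor ρ x :=
  (1 / 2 : ℝ) • (P.hatDGamma D DC nab X Y ξ x + P.hatDGamma D DC nab Y X ξ x)

/-- The skew-symmetric part of `D̂ γ`, applied to a spinor field. -/
def skewPart (X Y : Π x : M, TangentSpace (𝓡 n) x) (ξ : Π x : M, P.Spinor ρ x) (x : M) :
    P.Spinor ρ x :=
  (1 / 2 : ℝ) • (P.hatDGamma D DC nab X Y ξ x - P.hatDGamma D DC nab Y X ξ x)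

/-- The torsion `𝒯 (X, Y) ξ` of the spinor connection `D`. -/
def torsion (X Y : Π x : M, TangentSpace (𝓡 n) x) (ξ : Π x : M, P.Spinor ρ x) (x : M) :
    P.Spinor ρ x :=
  (2 : ℝ) • P.skewPart D DC nab X Y ξ x

/-- The symmetric part of `D̂ γ` acts trivially on the spinor field `ξ`. -/
def SymmPartActsTrivially (ξ : Π x : M, P.Spinor ρ x) : Prop :=
  ∀ (x : M) (X Y : Π x : M, TangentSpace (𝓡 n) x), DiffVecAt X x → DiffVecAt Y x →
    P.symmPart D DC nab X Y ξ x = 0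

/-- `ξ` is a smooth spinor field with `D ξ = 0`. -/
def IsParallel (D : CovariantDerivative (𝓡 n) F (P.Spinor ρ)) (ξ : Π x : M, P.Spinor ρ x) :
    Prop :=
  P.SmoothSpinor ξ ∧ ∀ x, D ξ x = 0

end SpinStructure

end Spin

end SpinGeom

end

/-!
Let `K` be the image of `{φ, ψ}` under a real-linear form `l` on the scalars, such as the real or
the imaginary part. As `C` is symmetric or skew-symmetric, `D` is in turn the connection
charge conjugate to `D^C`. So for `D^C`-parallel `φ` the Leibniz rule
reads `X (C (φ, ξ)) = C (φ, D_X ξ)`. For `ξ = γ (Y) ψ` and `D^C`-parallel `ψ`, subtracting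
`g (K, ∇_X Y)` from `X (g (K, Y))` leaves `g (∇_X K, Y) = 2 l (C (φ, (D̂_X γ)(Y) ψ))`. The symmetric
part of this identity computes `𝓛_K g`, and its skew-symmetric part is the torsion formula.
-/

namespace SpinGeom

theorem mvfderiv_clm_comp_apply {𝕜 : Type*} [NontriviallyNormedField 𝕜]
    {E : Type*} [NormedAddCommGroup E] [NormedSpace 𝕜 E] {H : Type*} [TopologicalSpace H]
    {I : ModelWithCorners 𝕜 E H} {M : Type*} [TopologicalSpace M] [ChartedSpace H M]
    {V W : Type*} [NormedAddCommGroup V] [NormedSpace 𝕜 V] [NormedAddCommGroup W] [NormedSpace 𝕜 W]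
    (L : V →L[𝕜] W) {f : M → V} {x : M} (hf : MDifferentiableAt I 𝓘(𝕜, V) f x)
    (v : TangentSpace I x) :
    mvfderiv I (fun y ↦ L (f y)) x v = L (mvfderiv I f x v) :=
  congrArg (fun A ↦ A v) (L.hasMFDerivAt.comp x hf.hasMFDerivAt).mfderiv

theorem cast_units_mul_self (u : ℤˣ) : ((u : ℤ) : ℝ) * ((u : ℤ) : ℝ) = 1 :=
  mod_cast Int.units_coe_mul_self u

namespace PseudoRiemannianMetric

variable {n : ℕ} {M : Type*} [TopologicalSpace M] [ChartedSpace (EuclideanSpace ℝ (Fin n)) M]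
  [IsManifold (𝓡 n) ∞ M] {g : PseudoRiemannianMetric (n := n) M}

theorem val_sharp (x : M) (α : TangentSpace (𝓡 n) x →ₗ[ℝ] ℝ) (w : TangentSpace (𝓡 n) x) :
    g.val x (g.sharp x α) w = α w :=
  LinearMap.BilinForm.apply_toDual_symm_apply (hB := g.bilin_nondegenerate x) α w

theorem mdifferentiableAt_val {X Y : Π x : M, TangentSpace (𝓡 n) x} {x : M}
    (hX : DiffVecAt X x) (hY : DiffVecAt Y x) :
    MDifferentiableAt (𝓡 n) 𝓘(ℝ, ℝ) (fun y ↦ g.val y (X y) (Y y)) x := by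
  have h : MDifferentiableAt (𝓡 n) ((𝓡 n).prod 𝓘(ℝ, ℝ))
      (fun y ↦ TotalSpace.mk' ℝ (E := Bundle.Trivial M ℝ) y (g.val y (X y) (Y y))) x :=
    MDifferentiableAt.clm_bundle_apply₂ (F₁ := EuclideanSpace ℝ (Fin n))
      (F₂ := EuclideanSpace ℝ (Fin n))
      ((g.contMDiff x).mdifferentiableAt (by simp)) hX hY
  exact ((mdifferentiableAt_totalSpace _ _).1 h).2

theorem IsLeviCivita.lieDeriv_eq {nab : CovariantDerivative (𝓡 n) (EuclideanSpace ℝ (Fin n))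
      (TangentSpace (𝓡 n) : M → Type _)} (hnab : g.IsLeviCivita nab)
    {K X Y : Π x : M, TangentSpace (𝓡 n) x} {x : M}
    (hK : DiffVecAt K x) (hX : DiffVecAt X x) (hY : DiffVecAt Y x) :
    g.lieDeriv K X Y x = g.val x (nab K x (X x)) (Y x) + g.val x (nab K x (Y x)) (X x) := by
  rw [lieDeriv, hnab.metric hX hY, ← hnab.torsionFree hK hX, ← hnab.torsionFree hK hY,
    g.symm x (nab K x (Y x))]
  simp only [map_sub, sub_apply]
  ring

end PseudoRiemannianMetric

/-- The charge conjugation as a continuous real bilinear map, for use in differential calculus. -/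
noncomputable def ChargeConjugation.formCLM {n : ℕ} {ε : Fin n → ℤˣ}
    {𝕜 : Type*} [RCLike 𝕜] {F : Type*} [NormedAddCommGroup F] [NormedSpace ℝ F]
    [NormedSpace 𝕜 F] [IsScalarTower ℝ 𝕜 F] [FiniteDimensional ℝ F]
    {ρ : CliffordAlgebra (cliffordForm ε) →ₐ[ℝ] Module.End 𝕜 F} (C : ChargeConjugation ρ) :
    F →L[ℝ] F →L[ℝ] 𝕜 :=
  (C.form.restrictScalars₁₂ ℝ ℝ).toContinuousBilinearMap

namespace SpinStructure

section Frame

variable {n : ℕ} {M : Type*} [TopologicalSpace M] [ChartedSpace (EuclideanSpace ℝ (Fin n)) M]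
  [IsManifold (𝓡 n) ∞ M] {g : PseudoRiemannianMetric (n := n) M} {ε : Fin n → ℤˣ} {ι : Type*}
  (P : SpinStructure g ε ι)

theorem coord_frame {i : ι} {x : M} (hx : x ∈ P.baseSet i) (a : Fin n) :
    P.coord i x (P.frame i a x) = Pi.single a 1 := by
  ext b
  rcases eq_or_ne b a with rfl | h
  · simp [coord, P.orthonormal i x hx, cast_units_mul_self]
  · simp [coord, P.orthonormal i x hx, h]

theorem coord_sum_smul_frame {i : ι} {x : M} (hx : x ∈ P.baseSet i) (c : Fin n → ℝ) :
    P.coord i x (∑ a, c a • P.frame i a x) = c := by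
  simp only [map_sum, map_smul, P.coord_frame hx]
  exact (pi_eq_sum_univ' c).symm

theorem coord_injective {i : ι} {x : M} (hx : x ∈ P.baseSet i) :
    Function.Injective (P.coord i x) := by
  have hdim : Module.finrank ℝ (TangentSpace (𝓡 n) x) = Module.finrank ℝ (Fin n → ℝ) :=
    (finrank_euclideanSpace_fin (𝕜 := ℝ) (n := n)).trans (Module.finrank_fin_fun ℝ).symm
  exact (LinearMap.injective_iff_surjective_of_finrank_eq_finrank hdim).2
    fun c ↦ ⟨_, P.coord_sum_smul_frame hx c⟩

theorem sum_coord_smul_frame {i : ι} {x : M} (hx : x ∈ P.baseSet i) (v : TangentSpace (𝓡 n) x) :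
    ∑ a, P.coord i x v a • P.frame i a x = v :=
  P.coord_injective hx (P.coord_sum_smul_frame hx _)

theorem baseSet_indexAt_mem_nhds (x : M) : P.baseSet (P.indexAt x) ∈ 𝓝 x :=
  (P.isOpen_baseSet _).mem_nhds (P.mem_baseSet_at x)

theorem contMDiffAt_frame (x : M) (a : Fin n) :
    ContMDiffAt (𝓡 n) ((𝓡 n).prod 𝓘(ℝ, EuclideanSpace ℝ (Fin n))) ∞
      (fun y ↦ TotalSpace.mk' (EuclideanSpace ℝ (Fin n)) y (P.frame (P.indexAt x) a y)) x :=
  (P.contMDiffOn_frame _ a).contMDiffAt (P.baseSet_indexAt_mem_nhds x)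

theorem mdifferentiableAt_coord {X : Π x : M, TangentSpace (𝓡 n) x} {x : M}
    (hX : DiffVecAt X x) (a : Fin n) :
    MDifferentiableAt (𝓡 n) 𝓘(ℝ, ℝ) (fun y ↦ P.coord (P.indexAt x) y (X y) a) x :=
  (PseudoRiemannianMetric.mdifferentiableAt_val
    ((P.contMDiffAt_frame x a).mdifferentiableAt (by simp)) hX).const_smul ((ε a : ℤ) : ℝ)

theorem contMDiffAt_of_coord {X : Π x : M, TangentSpace (𝓡 n) x} {x : M}
    (hX : ∀ a, ContMDiffAt (𝓡 n) 𝓘(ℝ, ℝ) ∞ (fun y ↦ P.coord (P.indexAt x) y (X y) a) x) :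
    ContMDiffAt (𝓡 n) ((𝓡 n).prod 𝓘(ℝ, EuclideanSpace ℝ (Fin n))) ∞
      (fun y ↦ TotalSpace.mk' (EuclideanSpace ℝ (Fin n)) y (X y)) x := by
  have hsum := ContMDiffAt.sum_section (s := Finset.univ) fun a _ ↦
    (hX a).smul_section (P.contMDiffAt_frame x a)
  refine hsum.congr_of_eventuallyEq ?_
  filter_upwards [P.baseSet_indexAt_mem_nhds x] with y hy
  exact congrArg (TotalSpace.mk' _ y) (P.sum_coord_smul_frame hy (X y)).symm

end Frame

variable {n : ℕ} {M : Type*} [TopologicalSpace M] [ChartedSpace (EuclideanSpace ℝ (Fin n)) M]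
  [IsManifold (𝓡 n) ∞ M] {g : PseudoRiemannianMetric (n := n) M} {ε : Fin n → ℤˣ} {ι : Type*}
  {P : SpinStructure g ε ι} {𝕜 : Type*} [RCLike 𝕜] {F : Type*} [NormedAddCommGroup F]
  [NormedSpace ℝ F] [NormedSpace 𝕜 F] [IsScalarTower ℝ 𝕜 F] [FiniteDimensional ℝ F]
  {ρ : CliffordAlgebra (cliffordForm ε) →ₐ[ℝ] Module.End 𝕜 F}

section Trivialization

variable (P ρ) in
/-- The spinor `ξ` at `x`, read in the trivialization of the spinor bundle given by the `i`-th
frame. -/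
noncomputable def spinorCoord (i : ι) (x : M) (ξ : P.Spinor ρ x) : F :=
  actionCLM ρ (P.trans (P.indexAt x) i x) ξ

theorem diffSpinorAt_iff {ξ : Π x : M, P.Spinor ρ x} {x : M} :
    P.DiffSpinorAt ξ x ↔
      MDifferentiableAt (𝓡 n) 𝓘(ℝ, F) (fun y ↦ P.spinorCoord ρ (P.indexAt x) y (ξ y)) x :=
  mdifferentiableAt_section _ _

theorem SmoothSpinor.diffSpinorAt {ξ : Π x : M, P.Spinor ρ x} (hξ : P.SmoothSpinor ξ) (x : M) :
    P.DiffSpinorAt ξ x :=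
  (hξ x).mdifferentiableAt (by simp)

theorem SmoothSpinor.contMDiffAt_spinorCoord {ξ : Π x : M, P.Spinor ρ x}
    (hξ : P.SmoothSpinor ξ) (x : M) :
    ContMDiffAt (𝓡 n) 𝓘(ℝ, F) ∞ (fun y ↦ P.spinorCoord ρ (P.indexAt x) y (ξ y)) x :=
  (contMDiffAt_section x).1 (hξ x)

theorem spinorCoord_clifford {i : ι} {x : M} (hx : x ∈ P.baseSet i) (v : TangentSpace (𝓡 n) x)
    (ξ : P.Spinor ρ x) :
    P.spinorCoord ρ i x (P.clifford ρ x v ξ) =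
      actionCLM ρ (CliffordAlgebra.ι (cliffordForm ε) (P.coord i x v)) (P.spinorCoord ρ i x ξ) := by
  have hv : ∑ a, P.coord (P.indexAt x) x v a • P.frame (P.indexAt x) a x =
      ∑ a, P.coord i x v a • P.frame i a x :=
    (P.sum_coord_smul_frame (P.mem_baseSet_at x) v).trans (P.sum_coord_smul_frame hx v).symm
  have hρ := congrArg ρ (P.trans_lift (P.indexAt x) i x ⟨P.mem_baseSet_at x, hx⟩ _ _ hv)
  rw [map_mul, map_mul] at hρ
  exact congrArg (fun A : Module.End 𝕜 F ↦ A ξ) hρ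

theorem spinorCoord_clifford_eq_sum {i : ι} {x : M} (hx : x ∈ P.baseSet i)
    (v : TangentSpace (𝓡 n) x) (ξ : P.Spinor ρ x) :
    P.spinorCoord ρ i x (P.clifford ρ x v ξ) = ∑ a, P.coord i x v a •
      actionCLM ρ (CliffordAlgebra.ι (cliffordForm ε) (Pi.single a 1)) (P.spinorCoord ρ i x ξ) := by
  rw [spinorCoord_clifford hx, pi_eq_sum_univ' (P.coord i x v)]
  simp [Pi.single_apply]

theorem form_spinorCoord (C : ChargeConjugation ρ) {i : ι} {x : M} (hx : x ∈ P.baseSet i)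
    (φ ψ : P.Spinor ρ x) :
    C.form (P.spinorCoord ρ i x φ) (P.spinorCoord ρ i x ψ) = P.pairing C x φ ψ :=
  C.spin_invariant _ (P.trans_mem (P.indexAt x) i x ⟨P.mem_baseSet_at x, hx⟩) φ ψ

theorem DiffSpinorAt.clifford {ξ : Π x : M, P.Spinor ρ x} {X : Π x : M, TangentSpace (𝓡 n) x}
    {x : M} (hξ : P.DiffSpinorAt ξ x) (hX : DiffVecAt X x) :
    P.DiffSpinorAt (fun y ↦ P.clifford ρ y (X y) (ξ y)) x := by
  rw [diffSpinorAt_iff] at hξ ⊢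
  have hsum := MDifferentiableAt.sum (t := Finset.univ) fun a _ ↦
    (P.mdifferentiableAt_coord hX a).smul
      ((actionCLM ρ (CliffordAlgebra.ι (cliffordForm ε) (Pi.single a 1))).mdifferentiableAt.comp
        x hξ)
  refine hsum.congr_of_eventuallyEq ?_
  filter_upwards [P.baseSet_indexAt_mem_nhds x] with y hy
  rw [Finset.sum_apply]
  exact spinorCoord_clifford_eq_sum hy (X y) (ξ y)

theorem DiffSpinorAt.pairing (C : ChargeConjugation ρ) {φ ψ : Π x : M, P.Spinor ρ x} {x : M}
    (hφ : P.DiffSpinorAt φ x) (hψ : P.DiffSpinorAt ψ x) :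
    MDifferentiableAt (𝓡 n) 𝓘(ℝ, 𝕜) (fun y ↦ P.pairing C y (φ y) (ψ y)) x := by
  rw [diffSpinorAt_iff] at hφ hψ
  refine ((C.formCLM.mdifferentiableAt.comp x hφ).clm_apply hψ).congr_of_eventuallyEq ?_
  filter_upwards [P.baseSet_indexAt_mem_nhds x] with y hy
  exact (form_spinorCoord C hy _ _).symm

theorem SmoothSpinor.contMDiffAt_C₁_frame (C : ChargeConjugation ρ) {φ ψ : Π x : M, P.Spinor ρ x}
    (hφ : P.SmoothSpinor φ) (hψ : P.SmoothSpinor ψ) (x : M) (a : Fin n) :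
    ContMDiffAt (𝓡 n) 𝓘(ℝ, 𝕜) ∞ (fun y ↦ P.C₁ C φ ψ y (P.frame (P.indexAt x) a y)) x := by
  let γ := actionCLM ρ (CliffordAlgebra.ι (cliffordForm ε) (Pi.single a 1))
  have hφx := C.formCLM.contMDiff.contMDiffAt.comp x
    (SmoothSpinor.contMDiffAt_spinorCoord hφ x)
  have hψx := γ.contMDiff.contMDiffAt.comp x (SmoothSpinor.contMDiffAt_spinorCoord hψ x)
  refine (hφx.clm_apply hψx).congr_of_eventuallyEq ?_
  filter_upwards [P.baseSet_indexAt_mem_nhds x] with y hy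
  refine (form_spinorCoord C hy _ _).symm.trans ?_
  rw [spinorCoord_clifford hy, P.coord_frame hy]
  rfl

end Trivialization

variable {C : ChargeConjugation ρ} {D DC : CovariantDerivative (𝓡 n) F (P.Spinor ρ)}
  {nab : CovariantDerivative (𝓡 n) (EuclideanSpace ℝ (Fin n)) (TangentSpace (𝓡 n) : M → Type _)}

section Pairing

theorem pairing_swap (x : M) (φ ψ : P.Spinor ρ x) :
    P.pairing C x φ ψ = ((C.Δ₀ : ℤ) : ℝ) • P.pairing C x ψ φ := by
  rw [RCLike.real_smul_eq_coe_mul, RCLike.ofReal_intCast]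
  exact C.symm₀ φ ψ

theorem pairing_add (x : M) (φ ξ η : P.Spinor ρ x) :
    P.pairing C x φ (ξ + η) = P.pairing C x φ ξ + P.pairing C x φ η :=
  map_add (C.form (φ : F)) (ξ : F) (η : F)

theorem pairing_smul (x : M) (c : ℝ) (φ ξ : P.Spinor ρ x) :
    P.pairing C x φ (c • ξ) = c • P.pairing C x φ ξ :=
  LinearMap.map_smul_of_tower (C.form (φ : F)) c (ξ : F)

theorem pairing_zero (x : M) (φ : P.Spinor ρ x) : P.pairing C x φ 0 = 0 :=
  map_zero (C.form (φ : F))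

theorem zero_pairing (x : M) (ψ : P.Spinor ρ x) : P.pairing C x 0 ψ = 0 :=
  LinearMap.map_zero₂ C.form (ψ : F)

theorem clifford_zero (x : M) (v : TangentSpace (𝓡 n) x) : P.clifford ρ x v 0 = 0 :=
  map_zero (ρ (CliffordAlgebra.ι (cliffordForm ε) (P.coord (P.indexAt x) x v)))

end Pairing

section ChargeConjugate

theorem IsChargeConjugate.symm (hDC : P.IsChargeConjugate C D DC) :
    P.IsChargeConjugate C DC D := by
  intro φ ψ x hφ hψ v
  have hswap : (fun y ↦ P.pairing C y (φ y) (ψ y)) = fun y ↦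
      (((C.Δ₀ : ℤ) : ℝ) • ContinuousLinearMap.id ℝ 𝕜) (P.pairing C y (ψ y) (φ y)) :=
    funext fun y ↦ pairing_swap y (φ y) (ψ y)
  rw [hswap, mvfderiv_clm_comp_apply _ (DiffSpinorAt.pairing C hψ hφ), hDC ψ φ x hψ hφ v,
    pairing_swap x (DC φ x v), pairing_swap x (φ x), ← smul_add, add_comm]
  rfl

theorem IsChargeConjugate.mvfderiv_pairing_clifford (hDC : P.IsChargeConjugate C D DC)
    (nab : CovariantDerivative (𝓡 n) (EuclideanSpace ℝ (Fin n)) (TangentSpace (𝓡 n) : M → Type _))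
    {φ ψ : Π x : M, P.Spinor ρ x} {Y : Π x : M, TangentSpace (𝓡 n) x} {x : M}
    (hφ : P.DiffSpinorAt φ x) (hψ : P.DiffSpinorAt ψ x) (hY : DiffVecAt Y x)
    (X : Π x : M, TangentSpace (𝓡 n) x) :
    mvfderiv (𝓡 n) (fun y ↦ P.pairing C y (φ y) (P.clifford ρ y (Y y) (ψ y))) x (X x) =
      P.pairing C x (DC φ x (X x)) (P.clifford ρ x (Y x) (ψ x))
        + (P.pairing C x (φ x) (P.hatDGamma D DC nab X Y ψ x)
          + P.pairing C x (φ x) (P.clifford ρ x (Y x) (DC ψ x (X x)))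
          + P.pairing C x (φ x) (P.clifford ρ x (nab Y x (X x)) (ψ x))) := by
  rw [hDC.symm _ _ x hφ (DiffSpinorAt.clifford hψ hY), ← pairing_add, ← pairing_add, hatDGamma,
    sub_add_cancel, sub_add_cancel]

end ChargeConjugate

theorem hatDGamma_add_swap (X Y : Π x : M, TangentSpace (𝓡 n) x) (ξ : Π x : M, P.Spinor ρ x)
    (x : M) :
    P.hatDGamma D DC nab X Y ξ x + P.hatDGamma D DC nab Y X ξ x =
      (2 : ℝ) • P.symmPart D DC nab X Y ξ x := by
  rw [symmPart]
  module

theorem hatDGamma_eq_symmPart_add_torsion (X Y : Π x : M, TangentSpace (𝓡 n) x)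
    (ξ : Π x : M, P.Spinor ρ x) (x : M) :
    P.hatDGamma D DC nab X Y ξ x =
      P.symmPart D DC nab X Y ξ x + (1 / 2 : ℝ) • P.torsion D DC nab X Y ξ x := by
  rw [symmPart, torsion, skewPart]
  module

section Bracket

variable (P C) in
/-- The component of the `𝕜`-valued vector field `{φ, ψ}` given by a real-linear form `l` on `𝕜`.
The real and imaginary parts are the cases `l = re` and `l = im`. -/
noncomputable def bracketComponent (l : 𝕜 →ₗ[ℝ] ℝ) (φ ψ : Π x : M, P.Spinor ρ x) (x : M) :
    TangentSpace (𝓡 n) x :=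
  g.sharp x (l ∘ₗ ((2 : ℝ) • P.C₁ C φ ψ x))

variable (l : 𝕜 →ₗ[ℝ] ℝ) {φ ψ : Π x : M, P.Spinor ρ x}

theorem val_bracketComponent (φ ψ : Π x : M, P.Spinor ρ x) (x : M) (v : TangentSpace (𝓡 n) x) :
    g.val x (P.bracketComponent C l φ ψ x) v =
      2 * l (P.pairing C x (φ x) (P.clifford ρ x v (ψ x))) := by
  rw [bracketComponent, PseudoRiemannianMetric.val_sharp, LinearMap.comp_apply,
    LinearMap.smul_apply, map_smul, smul_eq_mul]
  rfl

theorem contMDiffAt_bracketComponent (hφ : P.SmoothSpinor φ) (hψ : P.SmoothSpinor ψ) (x : M) :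
    ContMDiffAt (𝓡 n) ((𝓡 n).prod 𝓘(ℝ, EuclideanSpace ℝ (Fin n))) ∞
      (fun y ↦ TotalSpace.mk' (EuclideanSpace ℝ (Fin n)) y (P.bracketComponent C l φ ψ y)) x := by
  refine P.contMDiffAt_of_coord fun a ↦ ?_
  let L : 𝕜 →L[ℝ] ℝ := ((ε a : ℤ) : ℝ) • (2 : ℝ) • l.toContinuousLinearMap
  have hcoord (y : M) : P.coord (P.indexAt x) y (P.bracketComponent C l φ ψ y) a =
      L (P.C₁ C φ ψ y (P.frame (P.indexAt x) a y)) :=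
    congrArg (((ε a : ℤ) : ℝ) * ·) ((g.symm y _ _).trans (val_bracketComponent l φ ψ y _))
  simp only [hcoord]
  exact L.contMDiff.contMDiffAt.comp x (SmoothSpinor.contMDiffAt_C₁_frame C hφ hψ x a)

theorem val_nab_bracketComponent (hnab : g.IsLeviCivita nab) (hDC : P.IsChargeConjugate C D DC)
    (hφ : P.IsParallel DC φ) (hψ : P.IsParallel DC ψ) {x : M}
    (X : Π x : M, TangentSpace (𝓡 n) x) {Y : Π x : M, TangentSpace (𝓡 n) x}
    (hY : DiffVecAt Y x) :
    g.val x (nab (P.bracketComponent C l φ ψ) x (X x)) (Y x) =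
      2 * l (P.pairing C x (φ x) (P.hatDGamma D DC nab X Y ψ x)) := by
  have hφx := SmoothSpinor.diffSpinorAt hφ.1 x
  have hψx := SmoothSpinor.diffSpinorAt hψ.1 x
  have hK := (contMDiffAt_bracketComponent (C := C) l hφ.1 hψ.1 x).mdifferentiableAt (by simp)
  have hleibniz : mvfderiv (𝓡 n)
      (fun y ↦ P.pairing C y (φ y) (P.clifford ρ y (Y y) (ψ y))) x (X x) =
        P.pairing C x (φ x) (P.hatDGamma D DC nab X Y ψ x)
          + P.pairing C x (φ x) (P.clifford ρ x (nab Y x (X x)) (ψ x)) := by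
    rw [hDC.mvfderiv_pairing_clifford nab hφx hψx hY, hφ.2, hψ.2, zero_apply,
      clifford_zero, pairing_zero, zero_pairing, zero_add, add_zero]
  have hval : (fun y ↦ g.val y (P.bracketComponent C l φ ψ y) (Y y)) = fun y ↦
      ((2 : ℝ) • l.toContinuousLinearMap) (P.pairing C y (φ y) (P.clifford ρ y (Y y) (ψ y))) :=
    funext fun y ↦ val_bracketComponent l φ ψ y (Y y)
  have hmetric := hnab.metric hK hY (X x)
  rw [hval, mvfderiv_clm_comp_apply _ (DiffSpinorAt.pairing C hφx (DiffSpinorAt.clifford hψx hY)),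
    hleibniz, map_add, val_bracketComponent] at hmetric
  exact (add_right_cancel hmetric).symm

theorem lieDeriv_bracketComponent (hnab : g.IsLeviCivita nab) (hDC : P.IsChargeConjugate C D DC)
    (hφ : P.IsParallel DC φ) (hψ : P.IsParallel DC ψ) {x : M}
    {X Y : Π x : M, TangentSpace (𝓡 n) x} (hX : DiffVecAt X x) (hY : DiffVecAt Y x) :
    g.lieDeriv (P.bracketComponent C l φ ψ) X Y x =
      4 * l (P.pairing C x (φ x) (P.symmPart D DC nab X Y ψ x)) := by
  have hK := (contMDiffAt_bracketComponent (C := C) l hφ.1 hψ.1 x).mdifferentiableAt (by simp)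
  rw [hnab.lieDeriv_eq hK hX hY, val_nab_bracketComponent l hnab hDC hφ hψ X hY,
    val_nab_bracketComponent l hnab hDC hφ hψ Y hX, ← mul_add, ← map_add, ← pairing_add,
    hatDGamma_add_swap, pairing_smul, map_smul, smul_eq_mul]
  ring

theorem isKilling_bracketComponent (hnab : g.IsLeviCivita nab) (hDC : P.IsChargeConjugate C D DC)
    (hφ : P.IsParallel DC φ) (hψ : P.IsParallel DC ψ)
    (hψs : P.SymmPartActsTrivially D DC nab ψ) :
    g.IsKilling (P.bracketComponent C l φ ψ) := by
  refine ⟨contMDiffOn_univ.2 (contMDiffAt_bracketComponent l hφ.1 hψ.1), fun x X Y hX hY ↦ ?_⟩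
  rw [lieDeriv_bracketComponent l hnab hDC hφ hψ hX hY, hψs x X Y hX hY, pairing_zero, map_zero,
    mul_zero]

theorem val_nab_bracketComponent_eq_torsion (hnab : g.IsLeviCivita nab)
    (hDC : P.IsChargeConjugate C D DC) (hφ : P.IsParallel DC φ) (hψ : P.IsParallel DC ψ)
    (hψs : P.SymmPartActsTrivially D DC nab ψ) {x : M}
    {X Y : Π x : M, TangentSpace (𝓡 n) x} (hX : DiffVecAt X x) (hY : DiffVecAt Y x) :
    g.val x (nab (P.bracketComponent C l φ ψ) x (X x)) (Y x) =
      l (P.pairing C x (φ x) (P.torsion D DC nab X Y ψ x)) := by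
  rw [val_nab_bracketComponent l hnab hDC hφ hψ X hY, hatDGamma_eq_symmPart_add_torsion,
    hψs x X Y hX hY, zero_add, pairing_smul, map_smul, smul_eq_mul]
  ring

end Bracket

end SpinStructure

end SpinGeom

open SpinGeom.SpinStructure in
theorem theorem4p1_general {n : ℕ} {M : Type*} [TopologicalSpace M]
    [ChartedSpace (EuclideanSpace ℝ (Fin n)) M] [IsManifold (𝓡 n) ∞ M]
    {g : SpinGeom.PseudoRiemannianMetric (n := n) M} {ε : Fin n → ℤˣ} {ι : Type*}
    (P : SpinGeom.SpinStructure g ε ι)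
    {𝕜 : Type*} [RCLike 𝕜] {F : Type*} [NormedAddCommGroup F] [NormedSpace ℝ F]
    [NormedSpace 𝕜 F] [IsScalarTower ℝ 𝕜 F] [FiniteDimensional ℝ F]
    {ρ : CliffordAlgebra (SpinGeom.cliffordForm ε) →ₐ[ℝ] Module.End 𝕜 F}
    (C : SpinGeom.ChargeConjugation ρ)
    (nab : CovariantDerivative (𝓡 n) (EuclideanSpace ℝ (Fin n))
      (TangentSpace (𝓡 n) : M → Type _))
    (hnab : g.IsLeviCivita nab)
    (D DC : CovariantDerivative (𝓡 n) F (P.Spinor ρ))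
    (hDC : P.IsChargeConjugate C D DC)
    (φ ψ : Π x : M, P.Spinor ρ x)
    (hφ : P.IsParallel DC φ) (hψ : P.IsParallel DC ψ)
    (hψs : P.SymmPartActsTrivially D DC nab ψ) :
    (g.IsKilling (P.bracketRe C φ ψ) ∧ g.IsKilling (P.bracketIm C φ ψ)) ∧
    ∀ (x : M) (X Y : Π x : M, TangentSpace (𝓡 n) x),
      SpinGeom.DiffVecAt X x → SpinGeom.DiffVecAt Y x →
        (g.val x (nab (P.bracketRe C φ ψ) x (X x)) (Y x) : 𝕜)
          + (g.val x (nab (P.bracketIm C φ ψ) x (X x)) (Y x) : 𝕜) * RCLike.I =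
        P.pairing C x (φ x) (P.torsion D DC nab X Y ψ x) := by
  refine ⟨⟨isKilling_bracketComponent RCLike.reLm hnab hDC hφ hψ hψs,
    isKilling_bracketComponent RCLike.imLm hnab hDC hφ hψ hψs⟩, fun x X Y hX hY ↦ ?_⟩
  have hre := val_nab_bracketComponent_eq_torsion RCLike.reLm hnab hDC hφ hψ hψs hX hY
  have him := val_nab_bracketComponent_eq_torsion RCLike.imLm hnab hDC hφ hψ hψs hX hY
  exact (congrArg₂ (fun a b : ℝ ↦ (a : 𝕜) + (b : 𝕜) * RCLike.I) hre him).trans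
    (RCLike.re_add_im (P.pairing C x (φ x) (P.torsion D DC nab X Y ψ x)))

theorem theorem4p1 {n : ℕ} {M : Type*} [TopologicalSpace M] [T2Space M]
    [ChartedSpace (EuclideanSpace ℝ (Fin n)) M] [IsManifold (𝓡 n) ∞ M]
    {g : SpinGeom.PseudoRiemannianMetric (n := n) M} {ε : Fin n → ℤˣ} {ι : Type*}
    (P : SpinGeom.SpinStructure g ε ι)
    {𝕜 : Type*} [RCLike 𝕜] {F : Type*} [NormedAddCommGroup F] [NormedSpace ℝ F]
    [NormedSpace 𝕜 F] [IsScalarTower ℝ 𝕜 F] [FiniteDimensional ℝ F]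
    {ρ : CliffordAlgebra (SpinGeom.cliffordForm ε) →ₐ[ℝ] Module.End 𝕜 F}
    (C : SpinGeom.ChargeConjugation ρ)
    (nab : CovariantDerivative (𝓡 n) (EuclideanSpace ℝ (Fin n))
      (TangentSpace (𝓡 n) : M → Type _))
    (hnab : g.IsLeviCivita nab)
    (D DC : CovariantDerivative (𝓡 n) F (P.Spinor ρ))
    (hDC : P.IsChargeConjugate C D DC)
    (φ ψ : Π x : M, P.Spinor ρ x)
    (hφ : P.IsParallel DC φ) (hψ : P.IsParallel DC ψ)
    (hφs : P.SymmPartActsTrivially D DC nab φ) (hψs : P.SymmPartActsTrivially D DC nab ψ) :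
    (g.IsKilling (P.bracketRe C φ ψ) ∧ g.IsKilling (P.bracketIm C φ ψ)) ∧
    ∀ (x : M) (X Y : Π x : M, TangentSpace (𝓡 n) x),
      SpinGeom.DiffVecAt X x → SpinGeom.DiffVecAt Y x →
        (g.val x (nab (P.bracketRe C φ ψ) x (X x)) (Y x) : 𝕜)
          + (g.val x (nab (P.bracketIm C φ ψ) x (X x)) (Y x) : 𝕜) * RCLike.I =
        P.pairing C x (φ x) (P.torsion D DC nab X Y ψ x) :=
  theorem4p1_general P C nab hnab D DC hDC φ ψ hφ hψ hψs
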